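/- **Dilatation structures.** Let $(\Omega,\bar d)$ be a complete metric space whose closed balls $\bar B(x,3)$ are compact. A *dilatation structure* $(\Omega,\bar d,\bar\delta)$ consists of numbers $1<A<B$, sets $U(x)\supset B(x,B)$, $V_\varepsilon(x)$ (for $0<\varepsilon\le 1$), $W_\varepsilon(x)$ (for $\varepsilon>1$), and homeomorphisms $\bar\delta^x_\varepsilon:U(x)\to V_\varepsilon(x)$ for $0<\varepsilon\le1$ and $\bar\delta^x_\varepsilon:W_\varepsilon(x)\to U(x)$ for $\varepsilon>1$ ($x\in\Omega$), such that: (A0) for all $x$ and $\varepsilon\in(0,1)$, $B(x,\varepsilon)\subset\bar\delta^x_\varepsilon B(x,A)\subset V_\varepsilon(x)\subset W_{1/\varepsilon}(x)\subset\bar\delta^x_\varepsilon B(x,B)$; and for every compact $K$ there are $R>0$, $\varepsilon_0\in(0,1)$ with $\bar\delta^x_\varepsilon v\in W_{1/\varepsilon}(\bar\delta^x_\varepsilon u)$ for all $x\in K$, $u,v\in\bar B(x,R)$, $\varepsilon\in(0,\varepsilon_0)$; (A1) $\bar\delta^x_\varepsilon x=x$, $\bar\delta^x_1=\mathrm{id}$,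 the map $(\varepsilon,x,y)\mapsto\bar\delta^x_\varepsilon y$ is continuous on its domain in $(0,\infty)\times\Omega\times\Omega$ and extends continuously to the closure of this domain in $[0,\infty)\times\Omega\times\Omega$, and $\lim_{\varepsilon\to0}\bar\delta^x_\varepsilon y=x$ for $y\in U(x)$; (A2) $\bar\delta^x_\varepsilon\bar\delta^x_\mu u=\bar\delta^x_{\varepsilon\mu}u$ for $u\in U(x)$ whenever both sides are defined; (A3) for each $x$ there is a distance function $\bar d^x$ on $\bar B(x,A)$ such that $\sup\{|\frac1\varepsilon\bar d(\bar\delta^x_\varepsilon u,\bar\delta^x_\varepsilon v)-\bar d^x(u,v)|:u,v\in\bar B(x,A)\}\to0$ as $\varepsilon\to0$, uniformly for $x$ in compact sets. It is *strong* if moreover (A4) for every compact $K$ there is $R>0$ such that $\bar\delta^{\bar\delta^x_\varepsilon u}_{1/\varepsilon}\bar\delta^x_\varepsilon v$ converges as $\varepsilon\to0$, uniformly for $x\in K$ and $u,v\in\bar B(x,R)$. **Derivatives.** The tangent space at $x$ is the local group with product $\Sigma^x(u,v)=\lim_{\varepsilon\to0}\bar\delta^x_{1/\varepsilon}\bar\delta^{\bar\delta^x_\varepsilon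 u}_\varepsilon v$ and dilatations $\bar\delta^x_\varepsilon$. A curve $c$ is differentiable at $t$ if, with $x=c(t)$, there are $r>0$ and $f:(-r,r)\to U(x)$ such that $f(a+b)=\Sigma^x(f(a),f(b))$ whenever $a,b,a+b\in(-r,r)$, $f(\varepsilon a)=\bar\delta^x_\varepsilon f(a)$ for $\varepsilon\in(0,1]$, and $\frac1\varepsilon\bar d(c(t+\varepsilon a),\bar\delta^x_\varepsilon f(a))\to0$ as $\varepsilon\to0^+$, uniformly in $a\in(-r,r)$. The derivative is $\dot c(t)=f(1)$, that is, the tangent vector with $f(a)=\bar\delta^x_a\dot c(t)$ for small $a>0$. The structure has the *Radon–Nikodym property* if every $\bar d$-Lipschitz curve $c:[a,b]\to\Omega$ is differentiable at almost every $t\in[a,b]$. **Tempered structures.** A distance $d$ on $\Omega$ is a length distance if for all $x,y$ the number $d(x,y)$ is the infimum of the $d$-lengths of the $d$-Lipschitz curves from $x$ to $y$ (such curves existing). For constants $0<k<C$, let $\mathcal D(\Omega,\bar d,\bar\delta)$ be the class of all length distances $d$ on $\Omega$ such that for every $\varepsilon>0$ and every compact $K\subset\Omega$ there is $\rho>0$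 with $$k\,\bar d^x(u,v)\le\tfrac1\varepsilon d(\bar\delta^x_\varepsilon u,\bar\delta^x_\varepsilon v)\le C\,\bar d^x(u,v)$$ for all $x,u,v\in K$ with pairwise $\bar d$-distances at most $\rho$. The structure is *tempered* if $\bar d\in\mathcal D(\Omega,\bar d,\bar\delta)$ for some constants $0<k<C$. For $d\in\mathcal D(\Omega,\bar d,\bar\delta)$ put $\varphi_d(x,u)=\limsup_{\varepsilon\to0^+}\frac1\varepsilon d(x,\bar\delta^x_\varepsilon u)$; this is positively homogeneous in $u$, and $\varphi_d(c(t),\dot c(t))$ denotes $\frac1a\varphi_d(c(t),f(a))$ for small $a>0$, with $f$ as above (it equals $\varphi_d(c(t),f(1))$ if $f(1)$ is defined). **Proposition.** Let $(\Omega,\bar d,\bar\delta)$ be a strong dilatation structure that is tempered and has the Radon–Nikodym property, and let $d\in\mathcal D(\Omega,\bar d,\bar\delta)$ for some constants $0<k<C$. Then for every $\bar d$-Lipschitz curve $c:[a,b]\to\Omega$ the function $t\mapsto\varphi_d(c(t),\dot c(t))$ is integrable on $[a,b]$, and for all $x,y\in\Omega$ $$d(x,y)=\inf\Big\{\int_a^b\varphi_d(c(t),\dot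 c(t))\,dt\;:\;c:[a,b]\to\Omega\ \ \bar d\text{-Lipschitz},\ c(a)=x,\ c(b)=y\Big\}.$$ -/

import Mathlib

open Set Filter Topology MeasureTheory
open scoped ENNReal

noncomputable section

/-- `f` restricts to a homeomorphism from `s` onto `t` (subspace topologies). -/
def IsHomeoOn {X Y : Type*} [TopologicalSpace X] [TopologicalSpace Y]
    (f : X → Y) (s : Set X) (t : Set Y) : Prop :=
  BijOn f s t ∧ ContinuousOn f s ∧ ∃ g : Y → X, ContinuousOn g t ∧ InvOn g f s t

/-- The domain of the dilatation `δ^x_ε`: it is `U(x)` for `ε ≤ 1` and `W_ε(x)` for `ε > 1`. -/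
def dilDomain {X : Type*} (U : X → Set X) (W : X → ℝ → Set X) (x : X) (ε : ℝ) : Set X :=
  {y | if ε ≤ 1 then y ∈ U x else y ∈ W x ε}

/-- The total domain `dom δ ⊆ (0,∞) × X × X` of a field of dilatations. -/
def dilTotalDomain {X : Type*} (U : X → Set X) (W : X → ℝ → Set X) : Set (ℝ × X × X) :=
  {p | 0 < p.1 ∧ p.2.2 ∈ dilDomain U W p.2.1 p.1}

/-- A dilatation structure over the metric space `X`. Dilatations `δ x ε` are total functions,
meaningful only on `dilDomain U W x ε`; `tdist x u v` is the tangent distance `d^x(u,v)`,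
meaningful only for `u, v` in the closed ball of centre `x` and radius `A`. -/
structure DilatationStructure (X : Type*) [MetricSpace X] where
  /-- the common domain `U(x)` of the dilatations `δ^x_ε`, `ε ≤ 1` -/
  U : X → Set X
  /-- the image `V_ε(x)` of `δ^x_ε`, `ε ≤ 1` -/
  V : X → ℝ → Set X
  /-- the domain `W_ε(x)` of `δ^x_ε`, `ε > 1` -/
  W : X → ℝ → Set X
  /-- `δ x ε y` is `δ^x_ε y` -/
  δ : X → ℝ → X → X
  /-- the smaller radius -/
  A : ℝ
  /-- the larger radius -/
  B : ℝ
  /-- the tangent distances -/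
  tdist : X → X → X → ℝ
  complete : CompleteSpace X
  isCompact_closedBall : ∀ x : X, IsCompact (Metric.closedBall x 3)
  homeo_of_le_one : ∀ (x : X) (ε : ℝ), 0 < ε → ε ≤ 1 → IsHomeoOn (δ x ε) (U x) (V x ε)
  homeo_of_one_lt : ∀ (x : X) (ε : ℝ), 1 < ε → IsHomeoOn (δ x ε) (W x ε) (U x)
  -- inclusions between balls, images and domains
  one_lt_A : 1 < A
  A_lt_B : A < B
  ball_subset_U : ∀ x : X, Metric.ball x B ⊆ U x
  ball_subset_image : ∀ (x : X) (ε : ℝ), 0 < ε → ε < 1 →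
    Metric.ball x ε ⊆ δ x ε '' Metric.ball x A
  image_subset_V : ∀ (x : X) (ε : ℝ), 0 < ε → ε < 1 → δ x ε '' Metric.ball x A ⊆ V x ε
  V_subset_W : ∀ (x : X) (ε : ℝ), 0 < ε → ε < 1 → V x ε ⊆ W x ε⁻¹
  W_subset_image : ∀ (x : X) (ε : ℝ), 0 < ε → ε < 1 → W x ε⁻¹ ⊆ δ x ε '' Metric.ball x B
  mem_W_of_close : ∀ K : Set X, IsCompact K → ∃ R > 0, ∃ ε₀ ∈ Ioo (0 : ℝ) 1,
    ∀ x ∈ K, ∀ u ∈ Metric.closedBall x R, ∀ v ∈ Metric.closedBall x R, ∀ ε ∈ Ioo (0 : ℝ) ε₀,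
      δ x ε v ∈ W (δ x ε u) ε⁻¹
  -- base points, unit scale, joint continuity and contraction to the base point
  δ_self : ∀ (x : X) (ε : ℝ), 0 < ε → δ x ε x = x
  δ_one : ∀ (x : X), ∀ y ∈ U x, δ x 1 y = y
  continuous_extension : ∃ F : ℝ × X × X → X,
    ContinuousOn F (closure (dilTotalDomain U W)) ∧
      ∀ p ∈ dilTotalDomain U W, F p = δ p.2.1 p.1 p.2.2
  tendsto_δ : ∀ (x : X), ∀ y ∈ U x, Tendsto (fun ε : ℝ => δ x ε y) (𝓝[>] 0) (𝓝 x)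
  -- multiplicativity, where both sides are defined
  δ_δ : ∀ (x : X) (ε μ : ℝ), 0 < ε → 0 < μ → ∀ u ∈ U x,
    u ∈ dilDomain U W x μ → δ x μ u ∈ dilDomain U W x ε → u ∈ dilDomain U W x (ε * μ) →
      δ x ε (δ x μ u) = δ x (ε * μ) u
  -- `tdist x` is a distance on the closed ball of radius `A`, and it is a limit of
  -- rescaled distances
  tdist_eq_zero : ∀ x : X, ∀ u ∈ Metric.closedBall x A, ∀ v ∈ Metric.closedBall x A,
    (tdist x u v = 0 ↔ u = v)
  tdist_nonneg : ∀ x : X, ∀ u ∈ Metric.closedBall x A, ∀ v ∈ Metric.closedBall x A,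
    0 ≤ tdist x u v
  tdist_comm : ∀ x : X, ∀ u ∈ Metric.closedBall x A, ∀ v ∈ Metric.closedBall x A,
    tdist x u v = tdist x v u
  tdist_triangle : ∀ x : X, ∀ u ∈ Metric.closedBall x A, ∀ v ∈ Metric.closedBall x A,
    ∀ w ∈ Metric.closedBall x A, tdist x u w ≤ tdist x u v + tdist x v w
  tdist_limit : ∀ K : Set X, IsCompact K → ∀ η > 0, ∃ ε₀ > 0, ∀ ε ∈ Ioo (0 : ℝ) ε₀,
    ∀ x ∈ K, ∀ u ∈ Metric.closedBall x A, ∀ v ∈ Metric.closedBall x A,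
      |1 / ε * dist (δ x ε u) (δ x ε v) - tdist x u v| ≤ η

/-- `d` is a distance function on the set `X`. -/
structure IsDistance {X : Type*} (d : X → X → ℝ) : Prop where
  nonneg : ∀ x y, 0 ≤ d x y
  eq_zero_iff : ∀ x y, d x y = 0 ↔ x = y
  symm : ∀ x y, d x y = d y x
  triangle : ∀ x y z, d x z ≤ d x y + d y z

/-- The curve `c : [a,b] → X` is Lipschitz for the distance `d`. -/
def IsLipschitzCurve {X : Type*} (d : X → X → ℝ) (c : ℝ → X) (a b : ℝ) : Prop :=
  ∃ L : ℝ, ∀ s ∈ Icc a b, ∀ t ∈ Icc a b, d (c s) (c t) ≤ L * |s - t|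

/-- The length of the curve `c : [a,b] → X` for the distance `d`: the supremum of the sums
`∑ d (c tᵢ) (c tᵢ₊₁)` over the finite monotone sequences `tᵢ` in `[a,b]`. -/
def curveLength {X : Type*} (d : X → X → ℝ) (c : ℝ → X) (a b : ℝ) : ℝ≥0∞ :=
  ⨆ (n : ℕ) (τ : ℕ → ℝ) (_ : Monotone τ) (_ : ∀ i, τ i ∈ Icc a b),
    ∑ i ∈ Finset.range n, ENNReal.ofReal (d (c (τ i)) (c (τ (i + 1))))

/-- `d` is a length distance: any two points are joined by `d`-Lipschitz curves (otherwise the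
infimum is `∞`), and their distance is the infimum of the lengths of these curves. -/
def IsLengthDistance {X : Type*} (d : X → X → ℝ) : Prop :=
  IsDistance d ∧ ∀ x y : X, ENNReal.ofReal (d x y) =
    ⨅ (a : ℝ) (b : ℝ) (c : ℝ → X) (_ : a ≤ b) (_ : IsLipschitzCurve d c a b)
      (_ : c a = x) (_ : c b = y), curveLength d c a b

namespace DilatationStructure

variable {X : Type*} [MetricSpace X] (D : DilatationStructure X)

/-- The dilatation structure is strong: the approximate differences
`Δ^x_ε(u,v) = δ^{δ^x_ε u}_{1/ε} δ^x_ε v` converge, uniformly for `x` in a compact set and `u, v`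
in a ball around `x` (where they are defined for small `ε`). -/
def IsStrong : Prop :=
  ∃ Δ : X → X → X → X, ∀ K : Set X, IsCompact K → ∃ R > 0, ∀ η > 0, ∃ ε₀ > 0,
    ∀ ε ∈ Ioo (0 : ℝ) ε₀, ∀ x ∈ K, ∀ u ∈ Metric.closedBall x R, ∀ v ∈ Metric.closedBall x R,
      dist (D.δ (D.δ x ε u) ε⁻¹ (D.δ x ε v)) (Δ x u v) ≤ η

/-- `Σ^x(u,v) = w`: in the (local) tangent group at `x`, whose operation is
`Σ^x(u,v) = lim δ^x_{1/ε} δ^{δ^x_ε u}_ε v`, the product of `u` and `v` is `w`. -/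
def IsTangentMul (x u v w : X) : Prop :=
  (∀ᶠ ε in 𝓝[>] (0 : ℝ), v ∈ D.U (D.δ x ε u) ∧ D.δ (D.δ x ε u) ε v ∈ D.W x ε⁻¹) ∧
    Tendsto (fun ε : ℝ => D.δ x ε⁻¹ (D.δ (D.δ x ε u) ε v)) (𝓝[>] 0) (𝓝 w)

/-- `f` is a differential of the curve `c` at `t`: a morphism of conical groups from `ℝ` to the
tangent space at `c t`, defined near `0`, with `d(c(t + εa), δ^{c(t)}_ε f(a)) / ε → 0` uniformly
for `a` near `0`. Since the tangent space is a local group, `f` is only defined near `0`;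
when it is defined at `1`, `f 1` is the derivative of `c` at `t`. -/
def IsDifferential (c : ℝ → X) (t : ℝ) (f : ℝ → X) : Prop :=
  ∃ r > 0,
    (∀ a : ℝ, |a| < r → f a ∈ D.U (c t)) ∧
    (∀ a b : ℝ, |a| < r → |b| < r → |a + b| < r → D.IsTangentMul (c t) (f a) (f b) (f (a + b))) ∧
    (∀ a : ℝ, |a| < r → ∀ ε ∈ Ioc (0 : ℝ) 1, f (ε * a) = D.δ (c t) ε (f a)) ∧
    TendstoUniformlyOn (fun (ε : ℝ) (a : ℝ) => 1 / ε * dist (c (t + ε * a)) (D.δ (c t) ε (f a)))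
      (fun _ => 0) (𝓝[>] 0) {a | |a| < r}

/-- The Radon-Nikodym property: Lipschitz curves are differentiable almost everywhere. -/
def HasRadonNikodymProperty : Prop :=
  ∀ (a b : ℝ) (c : ℝ → X), a ≤ b → IsLipschitzCurve dist c a b →
    ∀ᵐ t ∂(volume.restrict (Icc a b)), ∃ f : ℝ → X, D.IsDifferential c t f

/-- The class of distances associated with the dilatation structure and the constants `k < C`.
"Sufficiently close" is: within a distance depending on a compact set that contains the points. -/
def distanceClass (k C : ℝ) : Set (X → X → ℝ) :=
  {d | 0 < k ∧ k < C ∧ IsLengthDistance d ∧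
    ∀ ε > 0, ∀ K : Set X, IsCompact K → ∃ ρ > 0, ∀ x ∈ K, ∀ u ∈ K, ∀ v ∈ K,
      dist x u ≤ ρ → dist x v ≤ ρ → dist u v ≤ ρ →
        k * D.tdist x u v ≤ 1 / ε * d (D.δ x ε u) (D.δ x ε v) ∧
          1 / ε * d (D.δ x ε u) (D.δ x ε v) ≤ C * D.tdist x u v}

/-- The dilatation structure is tempered: its own distance belongs to the associated class. -/
def IsTempered : Prop :=
  ∃ k C : ℝ, (dist : X → X → ℝ) ∈ D.distanceClass k C

/-- `φ_d(x,u) = limsup_{ε → 0} d(x, δ^x_ε u) / ε`. -/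
def phi (d : X → X → ℝ) (x u : X) : ℝ≥0∞ :=
  limsup (fun ε : ℝ => ENNReal.ofReal (1 / ε * d x (D.δ x ε u))) (𝓝[>] 0)

open Classical in
/-- The differential of the curve `c` at `t` (constant where `c` has none). -/
def differential (c : ℝ → X) (t : ℝ) : ℝ → X :=
  if h : ∃ f : ℝ → X, D.IsDifferential c t f then h.choose else fun _ => c t

/-- `φ_d(c(t), ċ(t))`. Since `φ_d(x, ·)` is positively homogeneous, and the differential `f` of
`c` at `t` satisfies `f(a) = δ^{c(t)}_a ċ(t)`, this is `φ_d(c(t), f(a)) / a` for any small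
`a > 0` (all of them give the same value), and `φ_d(c(t), f(1))` if `f` is defined at `1`. -/
def phiVelocity (d : X → X → ℝ) (c : ℝ → X) (t : ℝ) : ℝ≥0∞ :=
  limsup (fun a : ℝ => D.phi d (c t) (D.differential c t a) / ENNReal.ofReal a) (𝓝[>] 0)

end DilatationStructure

end

/-!
The integral of the velocity of a curve is its length. Comparing both `d` and the given distance
with the tangent distances at scale `ε = 1` shows that the two distances are locally
bilipschitz on compact sets, with a constant `M` that does not depend on the compact set. Hence, at
a point where a curve `c` has the differential `f`, replacing `δ^{c t}_ε f(a)` by `c (t + ε a)`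
changes `d(c t, ·)` by `o(ε)`, so `φ_d(c t, f(a)) = a · s(t)`, where
`s(t) = limsup_{h → 0+} d(c t, c (t + h)) / h` is the upper right speed of `c`
(`phi_eq_mul_upperSpeed`). By the Radon-Nikodym property, `φ_d(c, ċ)` is almost everywhere this
speed, which is measurable because it is a countable infimum of lower semicontinuous functions.

The length of a Lipschitz curve is the integral of its upper speed
(`eVariationOn_eq_lintegral_upperSpeed`): the speed is at most the derivative of the arc length,
whose integral is at most the length, and conversely `t ↦ dist (γ t) (γ s)` is a Lipschitz
function whose derivative is bounded by the speed.

It remains to see that the curves in the two infima are the same, that is, that a curve is Lipschitz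
for `d` if and only if it is Lipschitz for the given distance. One direction is local. The other
(`lipschitzWith_of_comp`) is not, because points far apart for the given distance could be close
for `d`, so that a `d`-Lipschitz curve might jump. Here the space is proper, being a length
space with compact balls of a fixed radius, so it is a countable union of compact balls, and
these are closed for `d`. Baire's theorem, applied to the closed set of times near which the
curve is not Lipschitz, gives a nonempty portion of this set that is mapped into one ball. On the
gaps of the portion the curve is Lipschitz with a fixed constant, so near the portion it stays in
a larger compact ball. There the two distances are comparable, so the curve is Lipschitz: a
contradiction.
-/

open scoped NNReal

/-! ### Length as the integral of the upper speed -/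

theorem curveLength_dist {Y : Type*} [PseudoMetricSpace Y] (γ : ℝ → Y) (a b : ℝ) :
    curveLength dist γ a b = eVariationOn γ (Icc a b) := by
  simp only [curveLength, eVariationOn, iSup_prod, iSup_subtype, iSup_and]
  refine iSup_congr fun n => iSup_congr fun τ => iSup_congr fun _ => iSup_congr fun _ =>
    Finset.sum_congr rfl fun i _ => ?_
  rw [edist_comm, edist_dist]

/-- The upper right metric derivative of the curve `γ` at `t`, in `[0, ∞]`. -/
noncomputable def upperSpeed {Y : Type*} [PseudoMetricSpace Y] (γ : ℝ → Y) (t : ℝ) : ℝ≥0∞ :=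
  limsup (fun h : ℝ => ENNReal.ofReal (1 / h * dist (γ t) (γ (t + h)))) (𝓝[>] 0)

section Speed

variable {Y : Type*} [PseudoMetricSpace Y] {γ : ℝ → Y}

theorem measurable_upperSpeed (hγ : Continuous γ) : Measurable (upperSpeed γ) := by
  have hb : (𝓝[>] (0 : ℝ)).HasBasis (fun _ : ℕ => True)
      fun n => Ioo (0 : ℝ) (1 / ((n : ℝ) + 1)) := by
    refine (nhdsGT_basis (0 : ℝ)).to_hasBasis (fun r hr => ?_) fun n _ => ⟨_, by positivity, le_rfl⟩
    obtain ⟨n, hn⟩ := exists_nat_one_div_lt hr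
    exact ⟨n, trivial, Ioo_subset_Ioo_right hn.le⟩
  have key : upperSpeed γ = fun t => ⨅ n : ℕ, ⨆ h ∈ Ioo (0 : ℝ) (1 / ((n : ℝ) + 1)),
      ENNReal.ofReal (1 / h * dist (γ t) (γ (t + h))) := by
    ext t
    simp only [upperSpeed, hb.limsup_eq_iInf_iSup, iInf_true]
  rw [key]
  refine Measurable.iInf fun n => LowerSemicontinuous.measurable ?_
  refine lowerSemicontinuous_iSup fun h => lowerSemicontinuous_iSup fun _ => ?_
  exact (ENNReal.continuous_ofReal.comp (by fun_prop)).lowerSemicontinuous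

theorem upperSpeed_le_of_hasDerivAt {g : ℝ → ℝ} {g' t : ℝ} (hg : HasDerivAt g g' t)
    (h : ∀ s, t ≤ s → dist (γ t) (γ s) ≤ g s - g t) :
    upperSpeed γ t ≤ ENNReal.ofReal g' := by
  have h1 : Tendsto (fun h : ℝ => ENNReal.ofReal (h⁻¹ • (g (t + h) - g t))) (𝓝[>] 0)
      (𝓝 (ENNReal.ofReal g')) :=
    (ENNReal.continuous_ofReal.tendsto _).comp hg.tendsto_slope_zero_right
  rw [← h1.limsup_eq]
  refine limsup_le_limsup ?_
  filter_upwards [self_mem_nhdsWithin] with x (hx : 0 < x)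
  refine ENNReal.ofReal_le_ofReal ?_
  rw [one_div, smul_eq_mul]
  exact mul_le_mul_of_nonneg_left (h _ (by linarith)) (by positivity)

theorem ofReal_abs_le_upperSpeed {g : ℝ → ℝ} {g' t : ℝ} (hg : HasDerivAt g g' t)
    (h : ∀ s, |g s - g t| ≤ dist (γ t) (γ s)) :
    ENNReal.ofReal |g'| ≤ upperSpeed γ t := by
  have h1 : Tendsto (fun h : ℝ => ENNReal.ofReal |h⁻¹ • (g (t + h) - g t)|) (𝓝[>] 0)
      (𝓝 (ENNReal.ofReal |g'|)) :=
    (ENNReal.continuous_ofReal.tendsto _).comp hg.tendsto_slope_zero_right.abs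
  rw [← h1.limsup_eq]
  refine limsup_le_limsup ?_
  filter_upwards [self_mem_nhdsWithin] with x (hx : 0 < x)
  refine ENNReal.ofReal_le_ofReal ?_
  rw [one_div, smul_eq_mul, abs_mul, abs_of_pos (inv_pos.2 hx)]
  exact mul_le_mul_of_nonneg_left (h _) (by positivity)

/-- The upper speed is at most the derivative of the arc length wherever this exists, and a monotone
function increases by at least the integral of its derivative. -/
theorem lintegral_upperSpeed_le_eVariationOn (hγ : LocallyBoundedVariationOn γ univ) {a b : ℝ}
    (hab : a ≤ b) : ∫⁻ t in Icc a b, upperSpeed γ t ≤ eVariationOn γ (Icc a b) := by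
  set l := variationOnFromTo γ univ a with hl
  have hmono : Monotone l := monotoneOn_univ.1 (variationOnFromTo.monotoneOn hγ (mem_univ a))
  have hsp : ∀ᵐ t, upperSpeed γ t ≤ ENNReal.ofReal (deriv l t) := by
    filter_upwards [hmono.ae_differentiableAt] with t ht
    refine upperSpeed_le_of_hasDerivAt ht.hasDerivAt fun s hts => ?_
    rw [dist_comm]
    have h2 := variationOnFromTo.add hγ (mem_univ a) (mem_univ t) (mem_univ s)
    have h4 : dist (γ s) (γ t) ≤ variationOnFromTo γ univ t s := by
      rw [variationOnFromTo.eq_of_le _ _ hts, dist_edist]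
      exact ENNReal.toReal_mono (hγ t s (mem_univ _) (mem_univ _))
        (eVariationOn.edist_le γ ⟨mem_univ _, hts, le_rfl⟩ ⟨mem_univ _, le_rfl, hts⟩)
    simp only [hl]; linarith
  have hint := (hmono.monotoneOn (uIcc a b)).intervalIntegrable_deriv
  have hle := (hmono.monotoneOn (uIcc a b)).intervalIntegral_deriv_mem_uIcc
  rw [uIcc_of_le (sub_nonneg.2 (hmono hab)), intervalIntegral.integral_of_le hab] at hle
  rw [intervalIntegrable_iff_integrableOn_Ioc_of_le hab] at hint
  calc ∫⁻ t in Icc a b, upperSpeed γ t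
      ≤ ∫⁻ t in Icc a b, ENNReal.ofReal (deriv l t) := lintegral_mono_ae (ae_restrict_of_ae hsp)
    _ = ∫⁻ t in Ioc a b, ENNReal.ofReal (deriv l t) := by
        rw [restrict_Ioc_eq_restrict_Icc]
    _ = ENNReal.ofReal (∫ t in Ioc a b, deriv l t) :=
        (ofReal_integral_eq_lintegral_ofReal hint (Eventually.of_forall fun t =>
          hmono.deriv_nonneg)).symm
    _ ≤ ENNReal.ofReal (l b - l a) := ENNReal.ofReal_le_ofReal hle.2
    _ = eVariationOn γ (Icc a b) := by
        rw [hl, variationOnFromTo.self, sub_zero, variationOnFromTo.eq_of_le _ _ hab,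
          ENNReal.ofReal_toReal (hγ a b (mem_univ _) (mem_univ _)), univ_inter]

/-- The distance to `γ s` is a Lipschitz function along `γ`, so it is the integral of its
derivative, which the upper speed dominates. -/
theorem edist_le_lintegral_upperSpeed {L : NNReal} (hγ : LipschitzWith L γ) {s t : ℝ}
    (hst : s ≤ t) : edist (γ t) (γ s) ≤ ∫⁻ τ in Ioc s t, upperSpeed γ τ := by
  set g : ℝ → ℝ := fun τ => dist (γ τ) (γ s) with hg
  have hL : LipschitzWith L g := by
    simpa [Function.comp_def] using (LipschitzWith.dist_left (γ s)).comp hγ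
  have hac : AbsolutelyContinuousOnInterval g s t := hL.lipschitzOnWith.absolutelyContinuousOnInterval
  have hftc := hac.integral_deriv_eq_sub
  rw [intervalIntegral.integral_of_le hst] at hftc
  have h0 : g s = 0 := dist_self _
  rw [h0, sub_zero] at hftc
  calc edist (γ t) (γ s) = ‖∫ τ in Ioc s t, deriv g τ‖ₑ := by
        rw [hftc, edist_dist, Real.enorm_of_nonneg dist_nonneg]
    _ ≤ ∫⁻ τ in Ioc s t, ‖deriv g τ‖ₑ := enorm_integral_le_lintegral_enorm _
    _ ≤ ∫⁻ τ in Ioc s t, upperSpeed γ τ := by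
        refine lintegral_mono_ae (ae_restrict_of_ae ?_)
        filter_upwards [hL.ae_differentiableAt] with τ hτ
        rw [← ofReal_norm, Real.norm_eq_abs]
        refine ofReal_abs_le_upperSpeed hτ.hasDerivAt fun σ => ?_
        rw [dist_comm (γ τ)]
        exact abs_dist_sub_le _ _ _

theorem eVariationOn_eq_lintegral_upperSpeed {L : NNReal} (hγ : LipschitzWith L γ) {a b : ℝ}
    (hab : a ≤ b) : eVariationOn γ (Icc a b) = ∫⁻ t in Icc a b, upperSpeed γ t := by
  refine le_antisymm (iSup_le fun ⟨n, u, hu, hmem⟩ => ?_)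
    (lintegral_upperSpeed_le_eVariationOn (hγ.locallyBoundedVariationOn _) hab)
  have key : ∀ m : ℕ, ∑ i ∈ Finset.range m, edist (γ (u (i + 1))) (γ (u i)) ≤
      ∫⁻ t in Ioc (u 0) (u m), upperSpeed γ t := by
    intro m
    induction m with
    | zero => simp
    | succ m ih =>
      rw [Finset.sum_range_succ, ← Ioc_union_Ioc_eq_Ioc (hu (Nat.zero_le m)) (hu m.le_succ),
        lintegral_union measurableSet_Ioc (Ioc_disjoint_Ioc_of_le le_rfl)]
      exact add_le_add ih (edist_le_lintegral_upperSpeed hγ (hu m.le_succ))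
  exact (key n).trans (lintegral_mono_set fun t ht =>
    ⟨(hmem 0).1.trans ht.1.le, ht.2.trans (hmem n).2⟩)

theorem upperSpeed_congr {γ' : ℝ → Y} {t : ℝ}
    (h : γ =ᶠ[𝓝 t] γ') : upperSpeed γ t = upperSpeed γ' t := by
  have h1 : Tendsto (fun h : ℝ => t + h) (𝓝[>] 0) (𝓝 t) :=
    (Continuous.tendsto' (by fun_prop) _ _ (add_zero t)).mono_left nhdsWithin_le_nhds
  refine limsup_congr ?_
  filter_upwards [h1.eventually h] with x hx
  rw [hx, h.eq_of_nhds]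

end Speed

/-! ### Length spaces with compact balls of a fixed radius are proper -/

/-- A curve from `x` to `y` whose length is almost `dist x y` meets the sphere of radius `R` around
`x` in a point `z` that is almost between `x` and `y`. -/
theorem exists_between_of_isLengthDistance {X : Type*} [MetricSpace X]
    (hlen : IsLengthDistance (dist : X → X → ℝ)) {x y : X} {R η : ℝ} (hR : 0 ≤ R)
    (hRxy : R ≤ dist x y) (hη : 0 < η) :
    ∃ z, dist x z = R ∧ dist z y ≤ dist x y - R + η := by
  have hlt : ENNReal.ofReal (dist x y) < ENNReal.ofReal (dist x y + η) :=
    (ENNReal.ofReal_lt_ofReal_iff (by positivity)).2 (by linarith)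
  rw [hlen.2 x y] at hlt
  simp only [iInf_lt_iff] at hlt
  obtain ⟨a, b, c, hab, ⟨L, hL⟩, rfl, rfl, hlt⟩ := hlt
  have hcont : ContinuousOn c (Icc a b) := by
    refine LipschitzOnWith.continuousOn (K := L.toNNReal) (.of_dist_le_mul fun s hs t ht => ?_)
    exact (hL s hs t ht).trans (mul_le_mul_of_nonneg_right (Real.le_coe_toNNReal L) (abs_nonneg _))
  obtain ⟨t, ht, htR⟩ : R ∈ (fun t => dist (c a) (c t)) '' Icc a b :=
    intermediate_value_Icc hab ((by fun_prop)) ⟨by simpa using hR, hRxy⟩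
  refine ⟨c t, htR, ?_⟩
  rw [curveLength_dist, ← univ_inter (Icc a b),
    ← eVariationOn.Icc_add_Icc c ht.1 ht.2 (mem_univ t)] at hlt
  have h1 := eVariationOn.edist_le c (s := univ ∩ Icc a t) ⟨mem_univ _, le_rfl, ht.1⟩
    ⟨mem_univ _, ht.1, le_rfl⟩
  have h2 := eVariationOn.edist_le c (s := univ ∩ Icc t b) ⟨mem_univ _, le_rfl, ht.2⟩
    ⟨mem_univ _, ht.2, le_rfl⟩
  have h3 := (add_le_add h1 h2).trans_lt hlt
  rw [edist_dist, edist_dist, ← ENNReal.ofReal_add dist_nonneg dist_nonneg,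
    ENNReal.ofReal_lt_ofReal_iff (by positivity)] at h3
  simp only at htR
  linarith

theorem properSpace_of_isLengthDistance {X : Type*} [MetricSpace X]
    (hlen : IsLengthDistance (dist : X → X → ℝ))
    (hcpt : ∀ x : X, IsCompact (Metric.closedBall x 3)) : ProperSpace X := by
  -- A ball of radius `n + 1` is covered by the balls of radius `3` around a finite `1`-net of the
  -- ball of radius `n`: each of its points is at distance at most `2` from the latter.
  have key : ∀ (n : ℕ) (x : X), IsCompact (Metric.closedBall x n) := by
    intro n x
    induction n with
    | zero => simp
    | succ n ih =>
      obtain ⟨t, -, ht, hcov⟩ := ih.finite_cover_balls one_pos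
      refine (ht.isCompact_biUnion fun z _ => hcpt z).of_isClosed_subset
        Metric.isClosed_closedBall fun y hy => ?_
      obtain ⟨w, hw, hwy⟩ : ∃ w ∈ Metric.closedBall x n, dist w y ≤ 2 := by
        rw [Metric.mem_closedBall, dist_comm] at hy
        push_cast at hy
        rcases le_total (n : ℝ) (dist x y) with h | h
        · obtain ⟨w, h1, h2⟩ :=
            exists_between_of_isLengthDistance hlen n.cast_nonneg h one_pos
          exact ⟨w, by rw [Metric.mem_closedBall, dist_comm, h1], by linarith⟩
        · exact ⟨y, by rwa [Metric.mem_closedBall, dist_comm], by simp⟩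
      obtain ⟨z, hz, hzw⟩ := mem_iUnion₂.1 (hcov hw)
      refine mem_iUnion₂.2 ⟨z, hz, ?_⟩
      rw [Metric.mem_ball] at hzw
      rw [Metric.mem_closedBall]
      linarith [dist_triangle y w z, dist_comm y w]
  refine ⟨fun x r => ?_⟩
  obtain ⟨n, hn⟩ := exists_nat_ge r
  exact (key n x).of_isClosed_subset Metric.isClosed_closedBall
    (Metric.closedBall_subset_closedBall hn)

/-! ### Curves whose image under a locally bilipschitz map is Lipschitz -/

/-- A continuous curve that is infinitesimally `K`-Lipschitz to the right of each point is
`K`-Lipschitz. -/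
theorem dist_le_of_forall_eventually_nhdsGT {E : Type*} [PseudoMetricSpace E] {f : ℝ → E}
    {K s t : ℝ} (hst : s ≤ t) (hf : ContinuousOn f (Icc s t))
    (h : ∀ τ ∈ Ico s t, ∀ᶠ σ in 𝓝[>] τ, dist (f τ) (f σ) ≤ K * (σ - τ)) :
    dist (f s) (f t) ≤ K * (t - s) := by
  have hcl : IsClosed ({τ | dist (f s) (f τ) ≤ K * (τ - s)} ∩ Icc s t) := by
    have hg : ContinuousOn (fun τ => dist (f s) (f τ) - K * (τ - s)) (Icc s t) := by fun_prop
    rw [inter_comm]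
    simpa only [preimage, mem_Iic, sub_nonpos] using
      hg.preimage_isClosed_of_isClosed isClosed_Icc (isClosed_Iic (a := (0 : ℝ)))
  refine hcl.Icc_subset_of_forall_mem_nhdsWithin (by simp) (fun τ hτ => ?_) ⟨hst, le_rfl⟩
  filter_upwards [h τ hτ.2] with σ hσ
  have h1 : dist (f s) (f τ) ≤ K * (τ - s) := hτ.1
  have := dist_triangle (f s) (f τ) (f σ)
  show dist (f s) (f σ) ≤ K * (σ - s)
  linarith

/-- The times near which the curve `c` is Lipschitz with constant `N`. -/
def regularSet {X : Type*} [PseudoMetricSpace X] (c : ℝ → X) (N : ℝ≥0) : Set ℝ :=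
  {t | ∃ U ∈ 𝓝 t, LipschitzOnWith N c U}

theorem isOpen_regularSet {X : Type*} [PseudoMetricSpace X] (c : ℝ → X) (N : ℝ≥0) :
    IsOpen (regularSet c N) := by
  refine isOpen_iff_mem_nhds.2 fun t ⟨U, hU, hc⟩ => ?_
  filter_upwards [eventually_mem_nhds_iff.2 hU] with s hs using ⟨U, hs, hc⟩

theorem dist_le_of_Icc_subset_regularSet {X : Type*} [PseudoMetricSpace X] {c : ℝ → X} {N : ℝ≥0}
    {s t : ℝ} (hst : s ≤ t)
    (h : Icc s t ⊆ regularSet c N) : dist (c s) (c t) ≤ N * (t - s) := by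
  refine dist_le_of_forall_eventually_nhdsGT hst (fun τ hτ => ?_) fun τ hτ => ?_
  · obtain ⟨U, hU, hc⟩ := h hτ
    exact (hc.continuousOn.continuousAt hU).continuousWithinAt
  · obtain ⟨U, hU, hc⟩ := h (Ico_subset_Icc_self hτ)
    filter_upwards [nhdsWithin_le_nhds hU, self_mem_nhdsWithin] with σ hσ (hlt : τ < σ)
    have := hc.dist_le_mul _ (mem_of_mem_nhds hU) _ hσ
    rwa [dist_comm τ, Real.dist_eq, abs_of_pos (sub_pos.2 hlt)] at this

/-- The map `j` is bilipschitz with constant `M` at small scales on each compact set. The scale may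
depend on the compact set, the constant may not. Nothing is required of points that are far apart,
so `j` need not be an embedding. -/
def IsLocallyBilipschitz {X Y : Type*} [PseudoMetricSpace X] [PseudoMetricSpace Y]
    (j : X → Y) (M : ℝ≥0) : Prop :=
  ∀ K : Set X, IsCompact K → ∃ ρ > 0, ∀ u ∈ K, ∀ v ∈ K, dist u v ≤ ρ →
    dist (j u) (j v) ≤ M * dist u v ∧ dist u v ≤ M * dist (j u) (j v)

namespace IsLocallyBilipschitz

variable {X Y : Type*} [MetricSpace X] [ProperSpace X] [MetricSpace Y] {j : X → Y} {M L : ℝ≥0}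

theorem eventually (hj : IsLocallyBilipschitz j M) (x : X) :
    ∀ᶠ p : X × X in 𝓝 (x, x), dist (j p.1) (j p.2) ≤ M * dist p.1 p.2 := by
  obtain ⟨ρ, hρ, h⟩ := hj _ (isCompact_closedBall x 1)
  have hpos : 0 < min 1 (ρ / 2) := by positivity
  rw [nhds_prod_eq]
  filter_upwards [prod_mem_prod (Metric.ball_mem_nhds x hpos) (Metric.ball_mem_nhds x hpos)]
    with p hp
  obtain ⟨h1, h2⟩ := hp
  rw [Metric.mem_ball, lt_min_iff] at h1 h2
  refine (h _ h1.1.le _ h2.1.le ?_).1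
  linarith [dist_triangle_right p.1 p.2 x]

theorem continuous (hj : IsLocallyBilipschitz j M) : Continuous j := by
  refine continuous_iff_continuousAt.2 fun x => tendsto_iff_dist_tendsto_zero.2 ?_
  have h1 : Tendsto (fun y : X => (y, x)) (𝓝 x) (𝓝 (x, x)) :=
    Continuous.tendsto' (by fun_prop) _ _ rfl
  refine squeeze_zero' (Eventually.of_forall fun _ => dist_nonneg) (h1.eventually (hj.eventually x))
    (Continuous.tendsto' (by fun_prop) _ _ (by simp))

theorem lipschitzWith_comp (hj : IsLocallyBilipschitz j M) {c : ℝ → X} (hc : LipschitzWith L c) :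
    LipschitzWith (M * L) (j ∘ c) := by
  refine LipschitzWith.of_dist_le_mul fun s t => ?_
  wlog hst : s ≤ t generalizing s t
  · rw [dist_comm, dist_comm s]; exact this t s (le_of_not_ge hst)
  rw [dist_comm s, Real.dist_eq, abs_of_nonneg (sub_nonneg.2 hst)]
  refine dist_le_of_forall_eventually_nhdsGT hst
    (hj.continuous.comp hc.continuous).continuousOn fun τ _ => ?_
  have h1 : Tendsto (fun σ => (c τ, c σ)) (𝓝[>] τ) (𝓝 (c τ, c τ)) :=
    ((continuous_const.prodMk hc.continuous).tendsto τ).mono_left nhdsWithin_le_nhds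
  filter_upwards [h1.eventually (hj.eventually _), self_mem_nhdsWithin] with σ hσ (hlt : τ < σ)
  refine hσ.trans ?_
  have h2 := hc.dist_le_mul τ σ
  rw [dist_comm τ, Real.dist_eq, abs_of_pos (sub_pos.2 hlt)] at h2
  push_cast
  rw [mul_assoc]
  exact mul_le_mul_of_nonneg_left h2 M.2

/-- On a compact set, points with close images are close, so the lower Lipschitz bound holds at
small scales of the target. -/
theorem exists_forall_dist_le (hj : IsLocallyBilipschitz j M) (hinj : Function.Injective j)
    {K : Set X} (hK : IsCompact K) :
    ∃ η > 0, ∀ u ∈ K, ∀ v ∈ K, dist (j u) (j v) < η → dist u v ≤ M * dist (j u) (j v) := by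
  obtain ⟨ρ, hρ, h⟩ := hj K hK
  have hS : IsCompact ((K ×ˢ K) ∩ {p : X × X | ρ ≤ dist p.1 p.2}) :=
    (hK.prod hK).inter_right (isClosed_le continuous_const continuous_dist)
  have hjc := hj.continuous
  obtain ⟨η, hη, hlt⟩ := hS.exists_forall_le' (f := fun p : X × X => dist (j p.1) (j p.2))
    (a := 0) (by fun_prop) fun p hp => dist_pos.2 fun h0 => by
      have : p.1 = p.2 := hinj h0
      have h2 : ρ ≤ dist p.1 p.2 := hp.2
      rw [this, dist_self] at h2
      linarith
  refine ⟨η, hη, fun u hu v hv huv => (h u hu v hv ?_).2⟩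
  by_contra! hcon
  exact (hlt (u, v) ⟨⟨hu, hv⟩, hcon.le⟩).not_gt huv

theorem isClosed_preimage (hj : IsLocallyBilipschitz j M) (hinj : Function.Injective j)
    {c : ℝ → X} (hc : Continuous (j ∘ c)) {K : Set X} (hK : IsCompact K) :
    IsClosed (c ⁻¹' K) := by
  have h := (hK.image hj.continuous).isClosed.preimage hc
  rwa [preimage_comp, hinj.preimage_image] at h

theorem exists_forall_dist_le_of_abs_sub_lt (hj : IsLocallyBilipschitz j M)
    (hinj : Function.Injective j) {c : ℝ → X} (hc : LipschitzWith L (j ∘ c)) {K : Set X} (hK : IsCompact K) :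
    ∃ r > 0, ∀ s t : ℝ, c s ∈ K → c t ∈ K → |s - t| < r → dist (c s) (c t) ≤ M * L * |s - t| := by
  obtain ⟨η, hη, h⟩ := hj.exists_forall_dist_le hinj hK
  refine ⟨η / (L + 1), by positivity, fun s t hs ht hst => ?_⟩
  have h1 := hc.dist_le_mul s t
  rw [Real.dist_eq] at h1
  have h2 : (L : ℝ) * |s - t| < η := by
    rw [lt_div_iff₀ (by positivity)] at hst
    nlinarith [abs_nonneg (s - t)]
  refine (h _ hs _ ht (h1.trans_lt h2)).trans ?_
  rw [mul_assoc]
  exact mul_le_mul_of_nonneg_left h1 M.2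

/-- The Lipschitz bound extends from `Ioc s t` to its left endpoint, although only `j ∘ c` is known
to be continuous there: the points `c σ` lie in a compact ball, whose preimage under `c` is closed. -/
theorem dist_le_of_Ioc_subset_regularSet (hj : IsLocallyBilipschitz j M)
    (hinj : Function.Injective j) {c : ℝ → X} (hc : Continuous (j ∘ c)) {N : ℝ≥0} {s t : ℝ}
    (hst : s < t) (h : Ioc s t ⊆ regularSet c N) : dist (c s) (c t) ≤ N * (t - s) := by
  have hcl := hj.isClosed_preimage hinj hc (isCompact_closedBall (c t) (N * (t - s)))
  have hsub : Ioc s t ⊆ c ⁻¹' Metric.closedBall (c t) (N * (t - s)) := fun σ hσ => by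
    have h1 := dist_le_of_Icc_subset_regularSet hσ.2
      ((Icc_subset_Ioc_iff hσ.2).2 ⟨hσ.1, le_rfl⟩ |>.trans h)
    refine h1.trans (mul_le_mul_of_nonneg_left (by linarith [hσ.1]) N.2)
  have := closure_minimal hsub hcl
  rw [closure_Ioc hst.ne] at this
  exact this ⟨le_rfl, hst.le⟩

theorem dist_le_of_Ico_subset_regularSet (hj : IsLocallyBilipschitz j M)
    (hinj : Function.Injective j) {c : ℝ → X} (hc : Continuous (j ∘ c)) {N : ℝ≥0} {s t : ℝ}
    (hst : s < t) (h : Ico s t ⊆ regularSet c N) : dist (c s) (c t) ≤ N * (t - s) := by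
  have hcl := hj.isClosed_preimage hinj hc (isCompact_closedBall (c s) (N * (t - s)))
  have hsub : Ico s t ⊆ c ⁻¹' Metric.closedBall (c s) (N * (t - s)) := fun σ hσ => by
    have h1 := dist_le_of_Icc_subset_regularSet hσ.1
      ((Icc_subset_Ico_iff hσ.1).2 ⟨le_rfl, hσ.2⟩ |>.trans h)
    rw [mem_preimage, Metric.mem_closedBall, dist_comm]
    refine h1.trans (mul_le_mul_of_nonneg_left (by linarith [hσ.2]) N.2)
  have := closure_minimal hsub hcl
  rw [closure_Ico hst.ne] at this
  rw [dist_comm]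
  exact this ⟨hst.le, le_rfl⟩

/-- If some time `e` is not regular, then `c t` is close to the image of a time between `e` and `t`
that is not regular, namely the one closest to `t`: the times after it are regular. -/
theorem exists_notMem_regularSet_dist_le (hj : IsLocallyBilipschitz j M)
    (hinj : Function.Injective j) {c : ℝ → X} (hc : Continuous (j ∘ c)) {N : ℝ≥0} {e t : ℝ}
    (he : e ∉ regularSet c N) :
    ∃ e' ∈ uIcc e t, e' ∉ regularSet c N ∧ dist (c e') (c t) ≤ N * |t - e| := by
  have hG := isOpen_regularSet c N
  by_cases htG : t ∈ regularSet c N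
  swap
  · exact ⟨t, right_mem_uIcc, htG, by rw [dist_self]; positivity⟩
  have hcpt : IsCompact (uIcc e t ∩ (regularSet c N)ᶜ) := isCompact_uIcc.inter_right hG.isClosed_compl
  have hne : (uIcc e t ∩ (regularSet c N)ᶜ).Nonempty := ⟨e, left_mem_uIcc, he⟩
  rcases le_total e t with hle | hle
  · obtain ⟨α, ⟨hα, hαG⟩, hmax⟩ := hcpt.exists_isGreatest hne
    refine ⟨α, hα, hαG, ?_⟩
    rw [uIcc_of_le hle] at hα hmax
    have hlt : α < t := hα.2.lt_of_ne fun h => hαG (h ▸ htG)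
    refine (hj.dist_le_of_Ioc_subset_regularSet (N := N) hinj hc hlt fun σ hσ => ?_).trans ?_
    · by_contra hσG
      exact (hmax ⟨⟨hα.1.trans hσ.1.le, hσ.2⟩, hσG⟩).not_gt hσ.1
    · rw [abs_of_nonneg (by linarith)]
      exact mul_le_mul_of_nonneg_left (by linarith [hα.1]) N.2
  · obtain ⟨α, ⟨hα, hαG⟩, hmin⟩ := hcpt.exists_isLeast hne
    refine ⟨α, hα, hαG, ?_⟩
    rw [uIcc_of_ge hle] at hα hmin
    have hlt : t < α := hα.1.lt_of_ne fun h => hαG (h ▸ htG)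
    rw [dist_comm]
    refine (hj.dist_le_of_Ico_subset_regularSet (N := N) hinj hc hlt fun σ hσ => ?_).trans ?_
    · by_contra hσG
      exact (hmin ⟨⟨hσ.1, hσ.2.le.trans hα.2⟩, hσG⟩).not_gt hσ.2
    · rw [abs_sub_comm, abs_of_nonneg (by linarith)]
      exact mul_le_mul_of_nonneg_left (by linarith [hα.2]) N.2

/-- By Baire's theorem, the curve maps the nonregular times near some nonregular time `e` into one
ball. It then maps a whole neighbourhood of `e` into a larger compact ball, on which `j` is
bilipschitz at small scales, so `e` is regular after all. -/
theorem regularSet_eq_univ (hj : IsLocallyBilipschitz j M) (hinj : Function.Injective j)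
    {c : ℝ → X} (hc : LipschitzWith L (j ∘ c)) : regularSet c (M * L) = univ := by
  by_contra hcon
  obtain ⟨e₀, he₀⟩ := (ne_univ_iff_exists_notMem _).1 hcon
  set E := (regularSet c (M * L))ᶜ with hE
  have hEcl : IsClosed E := (isOpen_regularSet c _).isClosed_compl
  have : CompleteSpace E := hEcl.completeSpace_coe
  have : Nonempty E := ⟨⟨e₀, he₀⟩⟩
  obtain ⟨n, ⟨e, heE⟩, hint⟩ := nonempty_interior_of_iUnion_of_closed (X := E)
    (f := fun n : ℕ => Subtype.val ⁻¹' (c ⁻¹' Metric.closedBall (c e₀) n))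
    (fun n => (hj.isClosed_preimage hinj hc.continuous (isCompact_closedBall _ _)).preimage
      continuous_subtype_val)
    (eq_univ_of_forall fun e => mem_iUnion.2 (exists_nat_ge (dist (c e) (c e₀))))
  rw [mem_interior_iff_mem_nhds, nhds_subtype_eq_comap, Filter.mem_comap] at hint
  obtain ⟨V, hV, hVsub⟩ := hint
  obtain ⟨ε, hε, hball⟩ := Metric.mem_nhds_iff.1 hV
  set N : ℝ≥0 := M * L with hN
  obtain ⟨r, hr, hlip⟩ := hj.exists_forall_dist_le_of_abs_sub_lt hinj hc
    (isCompact_closedBall (c e₀) (n + N * ε))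
  have hmem : ∀ t ∈ Metric.ball e ε, c t ∈ Metric.closedBall (c e₀) (n + N * ε) := by
    intro t ht
    obtain ⟨e', he', he'E, hd⟩ :=
      hj.exists_notMem_regularSet_dist_le hinj hc.continuous (t := t) heE
    have he'b : e' ∈ Metric.ball e ε :=
      (convex_ball e ε).ordConnected.uIcc_subset (Metric.mem_ball_self hε) ht he'
    have h1 : c e' ∈ Metric.closedBall (c e₀) n := hVsub (a := ⟨e', he'E⟩) (hball he'b)
    rw [Metric.mem_ball, Real.dist_eq] at ht
    rw [Metric.mem_closedBall] at h1 ⊢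
    have h2 : (N : ℝ) * |t - e| ≤ N * ε := mul_le_mul_of_nonneg_left ht.le N.2
    linarith [dist_triangle_left (c t) (c e₀) (c e')]
  refine heE ⟨Metric.ball e (min ε (r / 2)), Metric.ball_mem_nhds _ (by positivity), ?_⟩
  refine LipschitzOnWith.of_dist_le_mul fun s hs t ht => ?_
  have hs' := Metric.ball_subset_ball (min_le_left _ _) hs
  have ht' := Metric.ball_subset_ball (min_le_left _ _) ht
  rw [Real.dist_eq]
  refine (hlip s t (hmem s hs') (hmem t ht') ?_).trans (by push_cast; rfl)
  rw [← Real.dist_eq]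
  rw [Metric.mem_ball, lt_min_iff] at hs ht
  linarith [dist_triangle_right s t e]

theorem lipschitzWith_of_comp (hj : IsLocallyBilipschitz j M) (hinj : Function.Injective j)
    {c : ℝ → X} (hc : LipschitzWith L (j ∘ c)) : LipschitzWith (M * L) c := by
  refine LipschitzWith.of_dist_le_mul fun s t => ?_
  wlog hst : s ≤ t generalizing s t
  · rw [dist_comm, dist_comm s]; exact this t s (le_of_not_ge hst)
  rw [dist_comm s t, Real.dist_eq, abs_of_nonneg (sub_nonneg.2 hst)]
  exact dist_le_of_Icc_subset_regularSet hst
    (by rw [hj.regularSet_eq_univ hinj hc]; exact subset_univ _)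

end IsLocallyBilipschitz

/-! ### Metric spaces given by a distance function -/

/-- The set `X`, as a metric space with the distance `d`. -/
def DistanceSpace {X : Type*} {d : X → X → ℝ} (_ : IsDistance d) : Type _ := X

noncomputable instance {X : Type*} {d : X → X → ℝ} (h : IsDistance d) :
    MetricSpace (DistanceSpace h) where
  dist := d
  dist_self x := (h.eq_zero_iff x x).2 rfl
  dist_comm := h.symm
  dist_triangle := h.triangle
  eq_of_dist_eq_zero := (h.eq_zero_iff _ _).1

/-- The identity map from `X` to `X` with the distance `d`. -/
def toDistanceSpace {X : Type*} {d : X → X → ℝ} (h : IsDistance d) : X → DistanceSpace h := id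

theorem dist_toDistanceSpace {X : Type*} {d : X → X → ℝ} (h : IsDistance d) (x y : X) :
    dist (toDistanceSpace h x) (toDistanceSpace h y) = d x y := rfl

/-- A curve is Lipschitz on `[a, b]` if and only if its extension by constants is Lipschitz on
`ℝ`. -/
theorem isLipschitzCurve_iff {Y : Type*} [PseudoMetricSpace Y] {γ : ℝ → Y} {a b : ℝ}
    (hab : a ≤ b) : IsLipschitzCurve dist γ a b ↔
      ∃ L : ℝ≥0, LipschitzWith L fun t => γ (projIcc a b hab t) := by
  constructor
  · rintro ⟨L, hL⟩
    refine ⟨L.toNNReal, LipschitzWith.of_dist_le_mul fun s t => ?_⟩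
    have h1 := LipschitzWith.projIcc (h := hab) |>.dist_le_mul s t
    rw [NNReal.coe_one, one_mul] at h1
    refine (hL _ (projIcc a b hab s).2 _ (projIcc a b hab t).2).trans ?_
    exact (mul_le_mul_of_nonneg_right (Real.le_coe_toNNReal L) (abs_nonneg _)).trans
      (mul_le_mul_of_nonneg_left h1 NNReal.zero_le_coe)
  · rintro ⟨L, hL⟩
    refine ⟨L, fun s hs t ht => ?_⟩
    have := hL.dist_le_mul s t
    rwa [projIcc_of_mem hab hs, projIcc_of_mem hab ht, Real.dist_eq] at this

theorem IsLocallyBilipschitz.isLipschitzCurve_iff_dist {X : Type*} [MetricSpace X] [ProperSpace X]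
    {d : X → X → ℝ} {hd : IsDistance d} {M : ℝ≥0}
    (hj : IsLocallyBilipschitz (toDistanceSpace hd) M) {a b : ℝ} (hab : a ≤ b) {c : ℝ → X} :
    IsLipschitzCurve d c a b ↔ IsLipschitzCurve dist c a b := by
  refine (isLipschitzCurve_iff (γ := toDistanceSpace hd ∘ c) hab).trans
    (Iff.trans ?_ (isLipschitzCurve_iff hab).symm)
  exact ⟨fun ⟨_, h⟩ => ⟨_, hj.lipschitzWith_of_comp Function.injective_id h⟩,
    fun ⟨_, h⟩ => ⟨_, hj.lipschitzWith_comp h⟩⟩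

/-! ### The velocity of a curve in a dilatation structure -/

theorem map_mul_right_nhdsGT_zero {a : ℝ} (ha : 0 < a) :
    map (fun ε : ℝ => ε * a) (𝓝[>] 0) = 𝓝[>] 0 := by
  have h := (Homeomorph.mulRight₀ a ha.ne').isInducing.map_nhdsWithin_eq (Ioi 0) 0
  have h2 : (fun x : ℝ => x * a) '' Ioi 0 = Ioi 0 := by
    ext y
    exact ⟨fun ⟨x, hx, h⟩ => h ▸ mul_pos hx ha,
      fun hy => ⟨y / a, div_pos hy ha, div_mul_cancel₀ y ha.ne'⟩⟩
  simpa [h2] using h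

/-- A perturbation that tends to zero does not change the upper limit. -/
theorem limsup_ofReal_eq_of_tendsto {ι : Type*} {l : Filter ι} {u v w : ι → ℝ}
    (hw : Tendsto w l (𝓝 0)) (h : ∀ᶠ x in l, |u x - v x| ≤ w x) :
    limsup (fun x => ENNReal.ofReal (u x)) l = limsup (fun x => ENNReal.ofReal (v x)) l := by
  have hw' : Tendsto (fun x => ENNReal.ofReal (w x)) l (𝓝 0) := by
    simpa [Function.comp_def] using (ENNReal.continuous_ofReal.tendsto 0).comp hw
  have key : ∀ u v : ι → ℝ, (∀ᶠ x in l, |u x - v x| ≤ w x) →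
      limsup (fun x => ENNReal.ofReal (u x)) l ≤ limsup (fun x => ENNReal.ofReal (v x)) l := by
    intro u v h
    rw [← ENNReal.limsup_add_of_right_tendsto_zero hw' (fun x => ENNReal.ofReal (v x))]
    refine limsup_le_limsup ?_
    filter_upwards [h] with x hx
    refine (ENNReal.ofReal_le_ofReal ?_).trans ENNReal.ofReal_add_le
    linarith [le_abs_self (u x - v x)]
  exact le_antisymm (key u v h) (key v u (h.mono fun x hx => by rwa [abs_sub_comm]))

namespace DilatationStructure

variable {X : Type*} [MetricSpace X] (D : DilatationStructure X)

/-- At scale `ε = 1` and with base point `x = u`, the defining inequalities of the class compare `d`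
itself with the tangent distances. -/
theorem exists_tdist_bounds {k C : ℝ} {d : X → X → ℝ} (hd : d ∈ D.distanceClass k C) {K : Set X}
    (hK : IsCompact K) : ∃ ρ > 0, ∀ u ∈ K, ∀ v ∈ K, dist u v ≤ ρ →
      k * D.tdist u u v ≤ d u v ∧ d u v ≤ C * D.tdist u u v := by
  obtain ⟨-, -, -, h⟩ := hd
  obtain ⟨ρ, hρ, h⟩ := h 1 one_pos K hK
  refine ⟨min ρ 1, by positivity, fun u hu v hv huv => ?_⟩
  rw [le_min_iff] at huv
  have hB : 1 < D.B := D.one_lt_A.trans D.A_lt_B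
  have huU : u ∈ D.U u := D.ball_subset_U u (Metric.mem_ball_self (by linarith))
  have hvU : v ∈ D.U u := D.ball_subset_U u (by
    rw [Metric.mem_ball, dist_comm]; linarith [huv.2])
  have := h u hu u hu v hv (by simpa using hρ.le) huv.1 huv.1
  rwa [D.δ_one u u huU, D.δ_one u v hvU, div_one, one_mul] at this

/-- Both `d` and the distance of `X` are locally comparable with the tangent distances, hence with
each other. -/
theorem exists_isLocallyBilipschitz (htempered : D.IsTempered) {k C : ℝ} {d : X → X → ℝ}
    (hd : d ∈ D.distanceClass k C) :
    ∃ M, IsLocallyBilipschitz (toDistanceSpace hd.2.2.1.1) M := by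
  obtain ⟨k', C', hdist⟩ := htempered
  have hk := hd.1
  have hk' := hdist.1
  refine ⟨(max (C / k') (C' / k)).toNNReal, fun K hK => ?_⟩
  obtain ⟨ρ, hρ, h⟩ := D.exists_tdist_bounds hd hK
  obtain ⟨ρ', hρ', h'⟩ := D.exists_tdist_bounds hdist hK
  refine ⟨min ρ ρ', by positivity, fun u hu v hv huv => ?_⟩
  rw [le_min_iff] at huv
  obtain ⟨h1, h2⟩ := h u hu v hv huv.1
  obtain ⟨h1', h2'⟩ := h' u hu v hv huv.2
  have hC : 0 < C := hk.trans hd.2.1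
  have hC' : 0 < C' := hk'.trans hdist.2.1
  rw [dist_toDistanceSpace]
  have hM := Real.le_coe_toNNReal (max (C / k') (C' / k))
  constructor
  · calc d u v ≤ C * D.tdist u u v := h2
      _ ≤ C * (dist u v / k') := mul_le_mul_of_nonneg_left ((le_div_iff₀' hk').2 h1') hC.le
      _ = C / k' * dist u v := by ring
      _ ≤ _ := mul_le_mul_of_nonneg_right ((le_max_left _ _).trans hM) dist_nonneg
  · calc dist u v ≤ C' * D.tdist u u v := h2'
      _ ≤ C' * (d u v / k) := mul_le_mul_of_nonneg_left ((le_div_iff₀' hk).2 h1) hC'.le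
      _ = C' / k * d u v := by ring
      _ ≤ _ := mul_le_mul_of_nonneg_right ((le_max_right _ _).trans hM)
        (hd.2.2.1.1.nonneg u v)

variable {D}

/-- Replacing `δ^{c t}_ε v` by `c (t + ε a)` changes the distance to `c t` by `o(ε)`, and the
substitution `h = ε a` then turns `φ_d` into the upper speed. -/
theorem phi_eq_mul_upperSpeed [ProperSpace X] {d : X → X → ℝ} (hd : IsDistance d) {M : ℝ≥0}
    (hj : IsLocallyBilipschitz (toDistanceSpace hd) M) {c : ℝ → X} {t : ℝ}
    (hc : ContinuousAt c t) {v : X} (hv : v ∈ D.U (c t)) {a : ℝ} (ha : 0 < a)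
    (hlim : Tendsto (fun ε : ℝ => 1 / ε * dist (c (t + ε * a)) (D.δ (c t) ε v)) (𝓝[>] 0) (𝓝 0)) :
    D.phi d (c t) v = ENNReal.ofReal a * upperSpeed (toDistanceSpace hd ∘ c) t := by
  set j := toDistanceSpace hd
  have hct : Tendsto (fun ε : ℝ => c (t + ε * a)) (𝓝[>] 0) (𝓝 (c t)) :=
    hc.tendsto.comp ((Continuous.tendsto' (by fun_prop) _ _ (by simp)).mono_left
      nhdsWithin_le_nhds)
  have hev := (hct.prodMk_nhds (D.tendsto_δ (c t) v hv)).eventually (hj.eventually (c t))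
  calc D.phi d (c t) v
      = limsup (fun ε : ℝ => ENNReal.ofReal (1 / ε * d (c t) (c (t + ε * a)))) (𝓝[>] 0) := by
        refine limsup_ofReal_eq_of_tendsto (w := fun ε => M *
          (1 / ε * dist (c (t + ε * a)) (D.δ (c t) ε v))) (by simpa using hlim.const_mul (M : ℝ)) ?_
        filter_upwards [hev, self_mem_nhdsWithin] with ε hε (hpos : 0 < ε)
        rw [← mul_sub, abs_mul, abs_of_pos (one_div_pos.2 hpos), mul_left_comm]
        refine mul_le_mul_of_nonneg_left (le_trans ?_ hε) (by positivity)
        rw [hd.symm (c t), hd.symm (c t), dist_comm]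
        exact abs_dist_sub_le (j (D.δ (c t) ε v)) (j (c (t + ε * a))) (j (c t))
    _ = limsup (fun ε : ℝ => ENNReal.ofReal a *
          ENNReal.ofReal (1 / (ε * a) * d (c t) (c (t + ε * a)))) (𝓝[>] 0) := by
        refine limsup_congr (Eventually.of_forall fun ε => ?_)
        rw [← ENNReal.ofReal_mul ha.le]
        congr 1
        rw [← mul_assoc, one_div, one_div, mul_inv, mul_left_comm, mul_inv_cancel₀ ha.ne', mul_one]
    _ = ENNReal.ofReal a * limsup (fun ε : ℝ =>
          ENNReal.ofReal (1 / (ε * a) * d (c t) (c (t + ε * a)))) (𝓝[>] 0) :=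
        ENNReal.limsup_const_mul_of_ne_top ENNReal.ofReal_ne_top
    _ = ENNReal.ofReal a * upperSpeed (j ∘ c) t := by
        rw [upperSpeed]
        nth_rw 2 [← map_mul_right_nhdsGT_zero ha]
        rfl

theorem phiVelocity_eq_upperSpeed [ProperSpace X] {d : X → X → ℝ} (hd : IsDistance d) {M : ℝ≥0}
    (hj : IsLocallyBilipschitz (toDistanceSpace hd) M) {c : ℝ → X} {t : ℝ}
    (hc : ContinuousAt c t) (hdiff : ∃ f, D.IsDifferential c t f) :
    D.phiVelocity d c t = upperSpeed (toDistanceSpace hd ∘ c) t := by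
  have hf : D.IsDifferential c t (D.differential c t) := by
    rw [differential, dif_pos hdiff]
    exact hdiff.choose_spec
  obtain ⟨r, hr, hU, -, -, hlim⟩ := hf
  rw [phiVelocity, ← limsup_const (f := 𝓝[>] (0 : ℝ)) (upperSpeed (toDistanceSpace hd ∘ c) t)]
  refine limsup_congr ?_
  filter_upwards [Ioo_mem_nhdsGT hr] with a ⟨ha, har⟩
  have har' : |a| < r := by rwa [abs_of_pos ha]
  rw [phi_eq_mul_upperSpeed hd hj hc (hU a har') ha (hlim.tendsto_at har'), mul_comm,
    ENNReal.mul_div_cancel_right (by simpa using ha) ENNReal.ofReal_ne_top]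

theorem phiVelocity_ae_eq_upperSpeed [ProperSpace X] (hRN : D.HasRadonNikodymProperty)
    {d : X → X → ℝ} (hd : IsDistance d) {M : ℝ≥0}
    (hj : IsLocallyBilipschitz (toDistanceSpace hd) M) {a b : ℝ} (hab : a ≤ b) {c : ℝ → X}
    (hc : IsLipschitzCurve dist c a b) :
    D.phiVelocity d c =ᵐ[volume.restrict (Icc a b)]
      upperSpeed (toDistanceSpace hd ∘ fun t => c (projIcc a b hab t)) := by
  obtain ⟨L, hL⟩ := (isLipschitzCurve_iff hab).1 hc
  have hRN' := hRN a b c hab hc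
  rw [← restrict_Ioo_eq_restrict_Icc] at hRN' ⊢
  filter_upwards [hRN', ae_restrict_mem measurableSet_Ioo] with t hdiff ht
  have heq : (fun t => c (projIcc a b hab t)) =ᶠ[𝓝 t] c := by
    filter_upwards [Ioo_mem_nhds ht.1 ht.2] with s hs
    rw [projIcc_of_mem hab (Ioo_subset_Icc_self hs)]
  rw [phiVelocity_eq_upperSpeed hd hj (hL.continuous.continuousAt.congr heq) hdiff]
  exact (upperSpeed_congr (heq.fun_comp _)).symm

theorem lintegral_phiVelocity [ProperSpace X] (hRN : D.HasRadonNikodymProperty)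
    {d : X → X → ℝ} (hd : IsDistance d) {M : ℝ≥0}
    (hj : IsLocallyBilipschitz (toDistanceSpace hd) M) {a b : ℝ} (hab : a ≤ b) {c : ℝ → X}
    (hc : IsLipschitzCurve dist c a b) :
    ∫⁻ t in Icc a b, D.phiVelocity d c t = curveLength d c a b := by
  obtain ⟨L, hL⟩ := (isLipschitzCurve_iff hab).1 hc
  rw [lintegral_congr_ae (phiVelocity_ae_eq_upperSpeed hRN hd hj hab hc),
    ← eVariationOn_eq_lintegral_upperSpeed (hj.lipschitzWith_comp hL) hab]
  refine .trans ?_ (curveLength_dist (toDistanceSpace hd ∘ c) a b).symm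
  refine eVariationOn.congr fun s hs => ?_
  simp [projIcc_of_mem hab hs]

end DilatationStructure

/-! ### The distance as an infimum of integrals -/

theorem proposition42 {Ω : Type*} [MetricSpace Ω] (D : DilatationStructure Ω)
    (hstrong : D.IsStrong) (htempered : D.IsTempered) (hRN : D.HasRadonNikodymProperty)
    (k C : ℝ) (d : Ω → Ω → ℝ) (hd : d ∈ D.distanceClass k C) :
    (∀ (a b : ℝ) (c : ℝ → Ω), a ≤ b → IsLipschitzCurve dist c a b →
      AEMeasurable (D.phiVelocity d c) (volume.restrict (Icc a b)) ∧
        ∫⁻ t in Icc a b, D.phiVelocity d c t < ⊤) ∧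
    ∀ x y : Ω, ENNReal.ofReal (d x y) =
      ⨅ (a : ℝ) (b : ℝ) (c : ℝ → Ω) (_ : a ≤ b) (_ : IsLipschitzCurve dist c a b)
        (_ : c a = x) (_ : c b = y), ∫⁻ t in Icc a b, D.phiVelocity d c t := by
  have : ProperSpace Ω := by
    obtain ⟨k', C', hdist⟩ := htempered
    exact properSpace_of_isLengthDistance hdist.2.2.1 D.isCompact_closedBall
  obtain ⟨M, hj⟩ := D.exists_isLocallyBilipschitz htempered hd
  have hlen := hd.2.2.1
  refine ⟨fun a b c hab hc => ?_, fun x y => ?_⟩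
  · obtain ⟨L, hL⟩ := (isLipschitzCurve_iff hab).1 hc
    have hjL := hj.lipschitzWith_comp hL
    have hae := DilatationStructure.phiVelocity_ae_eq_upperSpeed hRN hlen.1 hj hab hc
    refine ⟨(measurable_upperSpeed hjL.continuous).aemeasurable.congr hae.symm, ?_⟩
    rw [lintegral_congr_ae hae, ← eVariationOn_eq_lintegral_upperSpeed hjL hab]
    have := (hjL.locallyBoundedVariationOn univ) a b (mem_univ _) (mem_univ _)
    rw [univ_inter] at this
    exact this.lt_top
  · rw [hlen.2 x y]
    refine iInf_congr fun a => iInf_congr fun b => iInf_congr fun c => iInf_congr fun hab =>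
      iInf_congr_Prop (hj.isLipschitzCurve_iff_dist hab) fun hc => iInf_congr fun _ =>
        iInf_congr fun _ => ?_
    exact (DilatationStructure.lintegral_phiVelocity hRN hlen.1 hj hab hc).symm
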